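/- Let $k$ be a field with $\operatorname{char} k\neq 3$ containing a primitive cube root of unity $\omega$, and let $l=k(\alpha)$, $\alpha^3=b\in k$, be a cubic field extension of $k$ (which is then cyclic), with norm $n_{l/k}$. Fix an isomorphism $\mathbb Z/3\mathbb Z\cong\operatorname{Gal}(l/k)$, let $\mu$ be the automorphism corresponding to $1+3\mathbb Z$, let $a\in k^\times$, and let $A=(l,a)=l\oplus lz\oplus lz^2$, with $z^3=a$ and $zu=\mu(u)z$ for $u\in l$, be the corresponding cyclic algebra, a central simple $k$-algebra of degree $3$. Let $n$ and $tr$ denote the reduced norm and the reduced trace of $A$, and for $x\in A$ with reduced characteristic polynomial $X^3-tr(x)X^2+s(x)X-n(x)$ put $x^\sharp=x^2-tr(x)x+s(x)1$. For $c\in k^\times$, the first Tits construction $J(A,c)$ is the Albert algebra with underlying vector space $A\oplus A\oplus A$, identity $(1,0,0)$ and $U$-operators $$U_v w=T(v,w)\,v-v^\sharp\times w,$$ where $$(a_1,a_2,a_3)^\sharp=(a_1^\sharp-a_2a_3,\;c^{-1}a_3^\sharp-a_1a_2,\;c\,a_2^\sharp-a_3a_1),\qquad v\times w=(v+w)^\sharp-v^\sharp-w^\sharp,$$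 $$T\big((a_1,a_2,a_3),(b_1,b_2,b_3)\big)=tr(a_1b_1)+tr(a_2b_3)+tr(a_3b_2).$$ It is a Jordan division algebra if every nonzero element $v$ is invertible, that is, if $U_v$ is bijective for every $v\neq 0$. For $e_1,e_2\in k$ let $\langle e_1,e_2\rangle\otimes n_{l/k}$ be the cubic form $(x,y)\mapsto e_1n_{l/k}(x)+e_2n_{l/k}(y)$ on $l\oplus l$; a form represents $t\in k^\times$ if it takes the value $t$. **Theorem.** Suppose that $A$ is a division algebra. If the cubic form $\langle c,a\rangle\otimes n_{l/k}$ represents $1$ or $a^2$, or if the cubic form $\langle c,a^2\rangle\otimes n_{l/k}$ represents $1$ or $a$, then $J(A,c)$ is not a Jordan division algebra. -/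

import Mathlib

open scoped TensorProduct

/-! ### Cyclic algebras of degree 3 -/

/-- The cyclic algebra `(l, a) = l ⊕ l z ⊕ l z²` of degree `3`, where `ρ` is the action of `ℤ/3ℤ` on
the `k`-algebra `l`; the triple `(x₀, x₁, x₂)` stands for `x₀ + x₁ z + x₂ z²`. -/
@[ext]
structure CyclicAlgebra {k l : Type*} [Field k] [CommRing l] [Algebra k l]
    (ρ : Multiplicative (ZMod 3) →* (l ≃ₐ[k] l)) (a : kˣ) where
  x₀ : l
  x₁ : l
  x₂ : l

namespace CyclicAlgebra

variable {k l : Type*} [Field k] [CommRing l] [Algebra k l]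

/-- The action on `l` of the generator `1 + 3ℤ` of `ℤ/3ℤ`. -/
def gen (ρ : Multiplicative (ZMod 3) →* (l ≃ₐ[k] l)) : l ≃ₐ[k] l :=
  ρ (Multiplicative.ofAdd 1)

theorem gen_gen_gen (ρ : Multiplicative (ZMod 3) →* (l ≃ₐ[k] l)) (u : l) :
    gen ρ (gen ρ (gen ρ u)) = u := by
  have h : gen ρ * gen ρ * gen ρ = 1 := by
    unfold gen
    rw [← map_mul, ← map_mul, ← map_one ρ]
    exact congrArg ρ (by decide)
  exact DFunLike.congr_fun h u

variable {ρ : Multiplicative (ZMod 3) →* (l ≃ₐ[k] l)} {a : kˣ}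

instance : Zero (CyclicAlgebra ρ a) := ⟨⟨0, 0, 0⟩⟩
instance : One (CyclicAlgebra ρ a) := ⟨⟨1, 0, 0⟩⟩
instance : Add (CyclicAlgebra ρ a) := ⟨fun x y => ⟨x.x₀ + y.x₀, x.x₁ + y.x₁, x.x₂ + y.x₂⟩⟩
instance : Neg (CyclicAlgebra ρ a) := ⟨fun x => ⟨-x.x₀, -x.x₁, -x.x₂⟩⟩
instance : Sub (CyclicAlgebra ρ a) := ⟨fun x y => ⟨x.x₀ - y.x₀, x.x₁ - y.x₁, x.x₂ - y.x₂⟩⟩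

/-- The multiplication determined by `z³ = a` and `z u = μ(u) z`, with `μ` the generator. -/
instance : Mul (CyclicAlgebra ρ a) := ⟨fun x y =>
  ⟨x.x₀ * y.x₀ + algebraMap k l a *
      (x.x₁ * gen ρ y.x₂ + x.x₂ * gen ρ (gen ρ y.x₁)),
   x.x₀ * y.x₁ + x.x₁ * gen ρ y.x₀ + algebraMap k l a * (x.x₂ * gen ρ (gen ρ y.x₂)),
   x.x₀ * y.x₂ + x.x₁ * gen ρ y.x₁ + x.x₂ * gen ρ (gen ρ y.x₀)⟩⟩

@[simp] theorem zero_x₀ : (0 : CyclicAlgebra ρ a).x₀ = 0 := rfl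
@[simp] theorem zero_x₁ : (0 : CyclicAlgebra ρ a).x₁ = 0 := rfl
@[simp] theorem zero_x₂ : (0 : CyclicAlgebra ρ a).x₂ = 0 := rfl
@[simp] theorem one_x₀ : (1 : CyclicAlgebra ρ a).x₀ = 1 := rfl
@[simp] theorem one_x₁ : (1 : CyclicAlgebra ρ a).x₁ = 0 := rfl
@[simp] theorem one_x₂ : (1 : CyclicAlgebra ρ a).x₂ = 0 := rfl
@[simp] theorem add_x₀ (x y : CyclicAlgebra ρ a) : (x + y).x₀ = x.x₀ + y.x₀ := rfl
@[simp] theorem add_x₁ (x y : CyclicAlgebra ρ a) : (x + y).x₁ = x.x₁ + y.x₁ := rfl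
@[simp] theorem add_x₂ (x y : CyclicAlgebra ρ a) : (x + y).x₂ = x.x₂ + y.x₂ := rfl
@[simp] theorem neg_x₀ (x : CyclicAlgebra ρ a) : (-x).x₀ = -x.x₀ := rfl
@[simp] theorem neg_x₁ (x : CyclicAlgebra ρ a) : (-x).x₁ = -x.x₁ := rfl
@[simp] theorem neg_x₂ (x : CyclicAlgebra ρ a) : (-x).x₂ = -x.x₂ := rfl
@[simp] theorem sub_x₀ (x y : CyclicAlgebra ρ a) : (x - y).x₀ = x.x₀ - y.x₀ := rfl
@[simp] theorem sub_x₁ (x y : CyclicAlgebra ρ a) : (x - y).x₁ = x.x₁ - y.x₁ := rfl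
@[simp] theorem sub_x₂ (x y : CyclicAlgebra ρ a) : (x - y).x₂ = x.x₂ - y.x₂ := rfl
@[simp] theorem mul_x₀ (x y : CyclicAlgebra ρ a) : (x * y).x₀ =
    x.x₀ * y.x₀ + algebraMap k l a * (x.x₁ * gen ρ y.x₂ + x.x₂ * gen ρ (gen ρ y.x₁)) := rfl
@[simp] theorem mul_x₁ (x y : CyclicAlgebra ρ a) : (x * y).x₁ =
    x.x₀ * y.x₁ + x.x₁ * gen ρ y.x₀ + algebraMap k l a * (x.x₂ * gen ρ (gen ρ y.x₂)) := rfl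
@[simp] theorem mul_x₂ (x y : CyclicAlgebra ρ a) : (x * y).x₂ =
    x.x₀ * y.x₂ + x.x₁ * gen ρ y.x₁ + x.x₂ * gen ρ (gen ρ y.x₀) := rfl

instance : AddCommGroup (CyclicAlgebra ρ a) where
  add_assoc x y z := by ext <;> simp [add_assoc]
  zero_add x := by ext <;> simp
  add_zero x := by ext <;> simp
  add_comm x y := by ext <;> simp [add_comm]
  neg_add_cancel x := by ext <;> simp
  sub_eq_add_neg x y := by ext <;> simp [sub_eq_add_neg]
  nsmul := nsmulRec
  zsmul := zsmulRec

instance : Ring (CyclicAlgebra ρ a) where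
  left_distrib x y z := by ext <;> simp <;> ring
  right_distrib x y z := by ext <;> simp <;> ring
  zero_mul x := by ext <;> simp
  mul_zero x := by ext <;> simp
  mul_assoc x y z := by ext <;> simp [gen_gen_gen] <;> ring
  one_mul x := by ext <;> simp
  mul_one x := by ext <;> simp
  neg_add_cancel := neg_add_cancel
  sub_eq_add_neg := sub_eq_add_neg
  zsmul := zsmulRec

instance : Algebra k (CyclicAlgebra ρ a) where
  smul t x := ⟨t • x.x₀, t • x.x₁, t • x.x₂⟩
  algebraMap :=
    { toFun := fun t => ⟨algebraMap k l t, 0, 0⟩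
      map_one' := by ext <;> simp
      map_mul' := fun s t => by ext <;> simp
      map_zero' := by ext <;> simp
      map_add' := fun s t => by ext <;> simp }
  commutes' t x := by ext <;> simp [mul_comm]
  smul_def' t x := by
    change (⟨t • x.x₀, t • x.x₁, t • x.x₂⟩ : CyclicAlgebra ρ a) = ⟨algebraMap k l t, 0, 0⟩ * x
    ext <;> simp [Algebra.smul_def]

end CyclicAlgebra

/-! ### Reduced norm, reduced trace and adjoint in degree 3 -/

section Reduced

variable (k : Type*) [Field k] {A : Type*} [Ring A] [Algebra k A]

/-- `p` is the reduced characteristic polynomial of the element `x` of a central simple `k`-algebra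
`A` of degree `3`: after extension of scalars to an algebraic closure, `A` becomes isomorphic to the
algebra of `3 × 3` matrices, and `p` is the characteristic polynomial of the matrix of `x`. -/
def IsReducedCharpoly (x : A) (p : Polynomial k) : Prop :=
  ∃ φ : (AlgebraicClosure k ⊗[k] A) ≃ₐ[AlgebraicClosure k]
      Matrix (Fin 3) (Fin 3) (AlgebraicClosure k),
    (φ (1 ⊗ₜ[k] x)).charpoly = p.map (algebraMap k (AlgebraicClosure k))

open Classical in
/-- The reduced characteristic polynomial `X³ - tr(x) X² + s(x) X - n(x)` of `x`
(`0` if there is none, which does not occur in a central simple algebra of degree `3`). -/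
noncomputable def reducedCharpoly (x : A) : Polynomial k :=
  if h : ∃ p : Polynomial k, IsReducedCharpoly k x p then h.choose else 0

/-- The reduced norm `n_{A/k}`. -/
noncomputable def reducedNorm (x : A) : k := -(reducedCharpoly k x).coeff 0

/-- The reduced trace `tr_{A/k}`. -/
noncomputable def reducedTrace (x : A) : k := -(reducedCharpoly k x).coeff 2

/-- The adjoint `x^♯ = x² - tr(x) x + s(x) 1`. -/
noncomputable def reducedAdjoint (x : A) : A :=
  x ^ 2 - reducedTrace k x • x + algebraMap k A ((reducedCharpoly k x).coeff 1)

end Reduced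

/-! ### The first Tits construction -/

/-- The vector space `A ⊕ A ⊕ A` underlying the first Tits construction `J(A, c)`. -/
abbrev FirstTits {k : Type*} [Field k] (A : Type*) [Ring A] [Algebra k A] (_c : kˣ) : Type _ :=
  A × A × A

namespace FirstTits

variable {k : Type*} [Field k] {A : Type*} [Ring A] [Algebra k A] (c : kˣ)

/-- The cubic norm `N` of `J(A, c)`. -/
noncomputable def norm (v : FirstTits A c) : k :=
  reducedNorm k v.1 + c * reducedNorm k v.2.1 + (c : k)⁻¹ * reducedNorm k v.2.2
    - reducedTrace k (v.1 * v.2.1 * v.2.2)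

/-- The adjoint map `♯` of `J(A, c)`. -/
noncomputable def sharp (v : FirstTits A c) : FirstTits A c :=
  (reducedAdjoint k v.1 - v.2.1 * v.2.2,
   (c : k)⁻¹ • reducedAdjoint k v.2.2 - v.1 * v.2.1,
   (c : k) • reducedAdjoint k v.2.1 - v.2.2 * v.1)

/-- The bilinearization `v × w` of `♯`. -/
noncomputable def cross (v w : FirstTits A c) : FirstTits A c :=
  sharp c (v + w) - sharp c v - sharp c w

/-- The trace form `T` of `J(A, c)`. -/
noncomputable def traceForm (v w : FirstTits A c) : k :=
  reducedTrace k (v.1 * w.1) + reducedTrace k (v.2.1 * w.2.2) + reducedTrace k (v.2.2 * w.2.1)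

/-- The `U`-operator `U_v w = T(v, w) v - v^♯ × w` of the quadratic Jordan algebra `J(A, c)`. -/
noncomputable def U (v w : FirstTits A c) : FirstTits A c :=
  traceForm c v w • v - cross c (sharp c v) w

end FirstTits

/-- A quadratic Jordan algebra, with `U`-operators `U v : V → V`, is a Jordan division algebra if
every nonzero element `v` is invertible, that is, if `U v` is bijective for all `v ≠ 0`. -/
def IsJordanDivision {V : Type*} [Zero V] (U : V → V → V) : Prop :=
  ∀ v : V, v ≠ 0 → Function.Bijective (U v)

/-! ### Forms -/

/-- The form `⟨c₁, …, c_m⟩ ⊗ N = c₁ N ⊥ … ⊥ c_m N` on `V^m`, for a form `N` on `V`. -/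
def diagTensor {k V : Type*} [CommRing k] {m : ℕ} (c : Fin m → k) (N : V → k) :
    (Fin m → V) → k :=
  fun x => ∑ i, c i * N (x i)

/-- The form `φ` represents `t`. -/
def Represents {k V : Type*} (φ : V → k) (t : k) : Prop :=
  ∃ x, φ x = t

/-! ### Automorphisms of matrix algebras preserve characteristic polynomials -/

/-! If `v ≠ 0` and `v^♯ = 0`, then `U_v w = T(v, w) v` stays on the line `k v`, so `U_v` cannot be
onto. When `c = n(p)` for a unit `p` of `A`, the vector `(1, p⁻¹, p)` is of this kind, because `u^♯
= n(u) u⁻¹` for every unit `u`. It therefore suffices that `c` be a reduced norm.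

By `reducedNorm_eq`, `n(x₀ + x₁ z + x₂ z²)` is `n(x₀) + a n(x₁) + a² n(x₂)`, with `n = n_{l/k}` on
the right, minus a trace that vanishes as soon as one coordinate is `0`. Each of the four
representations thus rewrites as `c n_{l/k}(x) = n(w)` with `w ≠ 0` having two terms, and
multiplicativity gives `c = n(w x⁻¹)`.

The remaining work makes the abstract reduced characteristic polynomial computable:
`baseChangeRep_bijective` shows that the regular representation over `l` splits `A`, and
`map_reducedCharpoly` identifies the two polynomials. -/

/-- Skolem–Noether: an automorphism of `End(V)` is conjugation by a linear automorphism of `V`, and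
conjugate endomorphisms share their characteristic polynomial. -/
theorem Matrix.charpoly_algEquiv {K n : Type*} [Field K] [Fintype n] [DecidableEq n]
    (f : Matrix n n K ≃ₐ[K] Matrix n n K) (M : Matrix n n K) :
    (f M).charpoly = M.charpoly := by
  obtain ⟨T, hT⟩ := LinearEquiv.conjAlgEquiv_surjective K (n → K) (n → K)
    ((Matrix.toLinAlgEquiv'.symm.trans f).trans Matrix.toLinAlgEquiv')
  have h : T.conj (Matrix.toLin' M) = Matrix.toLin' (f M) := by
    have h1 := congrArg (fun g => g (Matrix.toLinAlgEquiv' M)) hT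
    simp only [AlgEquiv.trans_apply, AlgEquiv.symm_apply_apply] at h1
    exact h1
  rw [← Matrix.charpoly_toLin' (f M), ← h, LinearEquiv.charpoly_conj, Matrix.charpoly_toLin']

/-- The reduced characteristic polynomial does not depend on the splitting of `A`. -/
theorem IsReducedCharpoly.unique {k : Type*} [Field k] {A : Type*} [Ring A] [Algebra k A]
    {x : A} {p q : Polynomial k} (hp : IsReducedCharpoly k x p) (hq : IsReducedCharpoly k x q) :
    p = q := by
  obtain ⟨φ, hφ⟩ := hp
  obtain ⟨ψ, hψ⟩ := hq
  apply Polynomial.map_injective _ (algebraMap k (AlgebraicClosure k)).injective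
  rw [← hφ, ← hψ, ← Matrix.charpoly_algEquiv (φ.symm.trans ψ)]
  simp

/-- Uniqueness makes the arbitrary `choose` harmless: exhibiting one splitting is enough to compute.
-/
theorem IsReducedCharpoly.reducedCharpoly_eq {k : Type*} [Field k] {A : Type*} [Ring A]
    [Algebra k A] {x : A} {p : Polynomial k} (hp : IsReducedCharpoly k x p) :
    reducedCharpoly k x = p := by
  have h : ∃ p : Polynomial k, IsReducedCharpoly k x p := ⟨p, hp⟩
  rw [reducedCharpoly, dif_pos h]
  exact h.choose_spec.unique hp

/-! ### The regular representation by 3 × 3 matrices over `l`. -/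

namespace CyclicAlgebra

section Representation

variable {k l : Type*} [Field k] [CommRing l] [Algebra k l]
  {ρ : Multiplicative (ZMod 3) →* (l ≃ₐ[k] l)} {a : kˣ}

@[simp] theorem smul_x₀ (t : k) (x : CyclicAlgebra ρ a) : (t • x).x₀ = t • x.x₀ := rfl
@[simp] theorem smul_x₁ (t : k) (x : CyclicAlgebra ρ a) : (t • x).x₁ = t • x.x₁ := rfl
@[simp] theorem smul_x₂ (t : k) (x : CyclicAlgebra ρ a) : (t • x).x₂ = t • x.x₂ := rfl

@[simp] theorem algebraMap_x₀ (t : k) :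
    (algebraMap k (CyclicAlgebra ρ a) t).x₀ = algebraMap k l t := rfl
@[simp] theorem algebraMap_x₁ (t : k) : (algebraMap k (CyclicAlgebra ρ a) t).x₁ = 0 := rfl
@[simp] theorem algebraMap_x₂ (t : k) : (algebraMap k (CyclicAlgebra ρ a) t).x₂ = 0 := rfl

variable (ρ a) in
/-- The `k`-linear coordinates of the cyclic algebra. -/
def coordEquiv : CyclicAlgebra ρ a ≃ₗ[k] l × l × l where
  toFun x := (x.x₀, x.x₁, x.x₂)
  invFun p := ⟨p.1, p.2.1, p.2.2⟩
  map_add' _ _ := rfl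
  map_smul' _ _ := rfl
  left_inv _ := rfl
  right_inv _ := rfl

variable (ρ a) in
/-- The regular representation of `(l, a)`: the rows of the matrix of `x` are the coordinates of
`x`, `z x` and `z² x` in the left `l`-basis `1, z, z²`. -/
def matrixRep : CyclicAlgebra ρ a →ₐ[k] Matrix (Fin 3) (Fin 3) l where
  toFun x := !![x.x₀, x.x₁, x.x₂;
    algebraMap k l a * gen ρ x.x₂, gen ρ x.x₀, gen ρ x.x₁;
    algebraMap k l a * gen ρ (gen ρ x.x₁), algebraMap k l a * gen ρ (gen ρ x.x₂),
      gen ρ (gen ρ x.x₀)]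
  map_one' := by
    ext i j; fin_cases i <;> fin_cases j <;> simp
  map_mul' x y := by
    ext i j; fin_cases i <;> fin_cases j <;>
      simp [Matrix.mul_apply, Fin.sum_univ_three, gen_gen_gen] <;> ring
  map_zero' := by
    ext i j; fin_cases i <;> fin_cases j <;> simp
  map_add' x y := by
    ext i j; fin_cases i <;> fin_cases j <;> simp [mul_add]
  commutes' t := by
    ext i j; fin_cases i <;> fin_cases j <;> simp [Matrix.algebraMap_matrix_apply]

theorem matrixRep_apply (x : CyclicAlgebra ρ a) : matrixRep ρ a x =
    !![x.x₀, x.x₁, x.x₂;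
      algebraMap k l a * gen ρ x.x₂, gen ρ x.x₀, gen ρ x.x₁;
      algebraMap k l a * gen ρ (gen ρ x.x₁), algebraMap k l a * gen ρ (gen ρ x.x₂),
        gen ρ (gen ρ x.x₀)] := rfl

theorem matrixRep_injective : Function.Injective (matrixRep ρ a) := by
  intro x y h
  ext
  · exact congrFun (congrFun h 0) 0
  · exact congrFun (congrFun h 0) 1
  · exact congrFun (congrFun h 0) 2

end Representation

/-! ### Splitting of `(l, a)` and descent of the characteristic polynomial to `k`. -/

section Splitting

variable {k l : Type*} [Field k] [Field l] [Algebra k l]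
  {ρ : Multiplicative (ZMod 3) →* (l ≃ₐ[k] l)} {a : kˣ}

theorem gen_ne_one (hρ : Function.Injective ρ) : gen ρ ≠ 1 := by
  unfold gen
  rw [Ne, map_eq_one_iff ρ hρ]
  decide

theorem gen_mul_gen_ne_one (hρ : Function.Injective ρ) : gen ρ * gen ρ ≠ 1 := by
  unfold gen
  rw [← map_mul, Ne, map_eq_one_iff ρ hρ]
  decide

theorem gen_mul_gen_ne_gen (hρ : Function.Injective ρ) : gen ρ * gen ρ ≠ gen ρ := by
  simpa using gen_ne_one hρ

/-- Dedekind's independence of the three conjugates of an embedding of `l`. -/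
theorem eq_zero_of_forall_conjugates {K : Type*} [Field K] (hρ : Function.Injective ρ)
    (σ : l →+* K) {c₀ c₁ c₂ : K}
    (h : ∀ u, c₀ * σ u + c₁ * σ (gen ρ u) + c₂ * σ (gen ρ (gen ρ u)) = 0) :
    c₀ = 0 ∧ c₁ = 0 ∧ c₂ = 0 := by
  let g : Fin 3 → (l ≃ₐ[k] l) := ![1, gen ρ, gen ρ * gen ρ]
  let F : Fin 3 → (l →* K) := fun i =>
    (σ : l →* K).comp ((g i : l →+* l) : l →* l)
  have hg : Function.Injective g := by
    intro i j hij
    have h1 := gen_ne_one hρ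
    have h2 := gen_mul_gen_ne_one hρ
    have h3 := gen_mul_gen_ne_gen hρ
    fin_cases i <;> fin_cases j <;> simp_all [g, eq_comm]
  have hF : Function.Injective F := by
    intro i j hij
    apply hg
    ext u
    exact σ.injective (DFunLike.congr_fun hij u)
  have hli := (linearIndependent_monoidHom l K).comp F hF
  have := Fintype.linearIndependent_iff.1 hli ![c₀, c₁, c₂] (by
    ext u
    simpa [Fin.sum_univ_three, F, g] using h u)
  exact ⟨this 0, this 1, this 2⟩

/-- The representation of `K ⊗ (l, a)` obtained from an embedding of `l` into `K`. -/
noncomputable def baseChangeRep {K : Type*} [Field K] [Algebra k K]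
    (ρ : Multiplicative (ZMod 3) →* (l ≃ₐ[k] l)) (a : kˣ) (σ : l →ₐ[k] K) :
    K ⊗[k] CyclicAlgebra ρ a →ₐ[K] Matrix (Fin 3) (Fin 3) K :=
  Algebra.TensorProduct.lift (Algebra.ofId K _) (σ.mapMatrix.comp (matrixRep ρ a))
    fun x _ => Algebra.commute_algebraMap_left x _

theorem baseChangeRep_tmul {K : Type*} [Field K] [Algebra k K] (σ : l →ₐ[k] K)
    (x : CyclicAlgebra ρ a) : baseChangeRep ρ a σ (1 ⊗ₜ x) = (matrixRep ρ a x).map σ :=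
  (Algebra.TensorProduct.lift_tmul _ _ _ _ _).trans (by rw [map_one, one_mul]; rfl)

/-- The summands `l`, `l z`, `l z²` fill three disjoint cyclic diagonals of the matrix, each with
entries `σ u`, `σ (μ u)`, `σ (μ² u)` up to factors `a`. A functional vanishing on the image gives on
each diagonal a linear relation between these conjugates, so by Dedekind it kills every matrix unit.
-/
theorem baseChangeRep_surjective {K : Type*} [Field K] [Algebra k K] (hρ : Function.Injective ρ)
    (σ : l →ₐ[k] K) : Function.Surjective (baseChangeRep ρ a σ) := by
  rw [← AlgHom.coe_toLinearMap, ← LinearMap.range_eq_top]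
  by_contra hne
  obtain ⟨f, hf0, hf⟩ := Submodule.exists_le_ker_of_lt_top _ (lt_top_iff_ne_top.2 hne)
  have key : ∀ x, f ((matrixRep ρ a x).map σ) = 0 := fun x =>
    hf ⟨1 ⊗ₜ x, by simp [baseChangeRep_tmul]⟩
  have ha : algebraMap k K a ≠ 0 := by simp
  let e (i j : Fin 3) : Matrix (Fin 3) (Fin 3) K := Matrix.single i j 1
  have h0 := eq_zero_of_forall_conjugates hρ (σ : l →+* K)
    (c₀ := f (e 0 0)) (c₁ := f (e 1 1)) (c₂ := f (e 2 2)) fun u => by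
      rw [← key ⟨u, 0, 0⟩]
      have : (matrixRep ρ a ⟨u, 0, 0⟩).map σ = σ u • e 0 0 + σ (gen ρ u) • e 1 1
          + σ (gen ρ (gen ρ u)) • e 2 2 := by
        ext i j; fin_cases i <;> fin_cases j <;> simp [matrixRep_apply, e]
      rw [this]
      simp [mul_comm]
  have h1 := eq_zero_of_forall_conjugates hρ (σ : l →+* K)
    (c₀ := f (e 0 1)) (c₁ := f (e 1 2)) (c₂ := algebraMap k K a * f (e 2 0)) fun u => by
      rw [← key ⟨0, u, 0⟩]
      have : (matrixRep ρ a ⟨0, u, 0⟩).map σ = σ u • e 0 1 + σ (gen ρ u) • e 1 2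
          + (algebraMap k K a * σ (gen ρ (gen ρ u))) • e 2 0 := by
        ext i j; fin_cases i <;> fin_cases j <;> simp [matrixRep_apply, e]
      rw [this]
      simp only [map_add, map_smul, smul_eq_mul, AlgHom.coe_toRingHom]
      ring
  have h2 := eq_zero_of_forall_conjugates hρ (σ : l →+* K)
    (c₀ := f (e 0 2)) (c₁ := algebraMap k K a * f (e 1 0))
    (c₂ := algebraMap k K a * f (e 2 1)) fun u => by
      rw [← key ⟨0, 0, u⟩]
      have : (matrixRep ρ a ⟨0, 0, u⟩).map σ = σ u • e 0 2
          + (algebraMap k K a * σ (gen ρ u)) • e 1 0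
          + (algebraMap k K a * σ (gen ρ (gen ρ u))) • e 2 1 := by
        ext i j; fin_cases i <;> fin_cases j <;> simp [matrixRep_apply, e]
      rw [this]
      simp only [map_add, map_smul, smul_eq_mul, AlgHom.coe_toRingHom]
      ring
  apply hf0
  apply Matrix.ext_linearMap
  intro i j
  apply LinearMap.ext_ring
  -- Below the diagonal the coefficients carry a factor `a ≠ 0`, which cancels.
  simp only [mul_eq_zero, ha, false_or] at h0 h1 h2
  fin_cases i <;> fin_cases j
  · exact h0.1
  · exact h1.1
  · exact h2.1
  · exact h2.2.1
  · exact h0.2.1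
  · exact h1.2.1
  · exact h1.2.2
  · exact h2.2.2
  · exact h0.2.2

theorem finrank_eq (hdim : Module.finrank k l = 3) :
    Module.finrank k (CyclicAlgebra ρ a) = 9 := by
  have : Module.Finite k l := Module.finite_of_finrank_eq_succ hdim
  rw [(coordEquiv ρ a).finrank_eq, Module.finrank_prod, Module.finrank_prod, hdim]

theorem baseChangeRep_bijective {K : Type*} [Field K] [Algebra k K]
    (hdim : Module.finrank k l = 3) (hρ : Function.Injective ρ) (σ : l →ₐ[k] K) :
    Function.Bijective (baseChangeRep ρ a σ) := by
  have : Module.Finite k (CyclicAlgebra ρ a) := Module.finite_of_finrank_eq_succ (finrank_eq hdim)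
  have hs := baseChangeRep_surjective (a := a) hρ σ
  refine ⟨?_, hs⟩
  have hd : Module.finrank K (K ⊗[k] CyclicAlgebra ρ a)
      = Module.finrank K (Matrix (Fin 3) (Fin 3) K) := by
    rw [Module.finrank_baseChange, finrank_eq hdim, Module.finrank_matrix]
    simp
  exact (LinearMap.injective_iff_surjective_of_finrank_eq_finrank
    (f := (baseChangeRep ρ a σ).toLinearMap) hd).2 hs

theorem isReducedCharpoly (hdim : Module.finrank k l = 3) (hρ : Function.Injective ρ)
    {x : CyclicAlgebra ρ a} {p : Polynomial k}
    (hp : (matrixRep ρ a x).charpoly = p.map (algebraMap k l)) : IsReducedCharpoly k x p := by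
  have : Module.Finite k l := Module.finite_of_finrank_eq_succ hdim
  let σ : l →ₐ[k] AlgebraicClosure k := IsAlgClosed.lift
  refine ⟨AlgEquiv.ofBijective _ (baseChangeRep_bijective hdim hρ σ), ?_⟩
  rw [AlgEquiv.ofBijective_apply, baseChangeRep_tmul]
  have := Matrix.charpoly_map (matrixRep ρ a x) (σ : l →+* AlgebraicClosure k)
  rw [AlgHom.coe_toRingHom] at this
  rw [this, hp, Polynomial.map_map, AlgHom.comp_algebraMap]

/-- The powers of the generator exhaust the automorphism group of `l` over `k`. -/
theorem univ_aut [Fintype (l ≃ₐ[k] l)] [DecidableEq (l ≃ₐ[k] l)]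
    (hdim : Module.finrank k l = 3) (hρ : Function.Injective ρ) :
    (Finset.univ : Finset (l ≃ₐ[k] l)) = {1, gen ρ, gen ρ * gen ρ} := by
  have : Module.Finite k l := Module.finite_of_finrank_eq_succ hdim
  symm
  apply Finset.eq_univ_of_card
  have h1 : Fintype.card (l ≃ₐ[k] l) ≤ 3 := by
    rw [← hdim]
    convert AlgEquiv.card_le (F := k) (K := l)
  have h2 : ({1, gen ρ, gen ρ * gen ρ} : Finset (l ≃ₐ[k] l)).card = 3 :=
    Finset.card_eq_three.2 ⟨_, _, _, (gen_ne_one hρ).symm, (gen_mul_gen_ne_one hρ).symm,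
      (gen_mul_gen_ne_gen hρ).symm, rfl⟩
  have h3 := Finset.card_le_univ ({1, gen ρ, gen ρ * gen ρ} : Finset (l ≃ₐ[k] l))
  omega

theorem isGalois (hdim : Module.finrank k l = 3) (hρ : Function.Injective ρ) : IsGalois k l := by
  classical
  have : Module.Finite k l := Module.finite_of_finrank_eq_succ hdim
  apply IsGalois.of_card_aut_eq_finrank
  rw [hdim, Nat.card_eq_fintype_card, ← Finset.card_univ, univ_aut hdim hρ]
  exact Finset.card_eq_three.2 ⟨_, _, _, (gen_ne_one hρ).symm, (gen_mul_gen_ne_one hρ).symm,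
    (gen_mul_gen_ne_gen hρ).symm, rfl⟩

theorem algebraMap_trace_eq (hdim : Module.finrank k l = 3) (hρ : Function.Injective ρ) (u : l) :
    algebraMap k l (Algebra.trace k l u) = u + gen ρ u + gen ρ (gen ρ u) := by
  classical
  have : Module.Finite k l := Module.finite_of_finrank_eq_succ hdim
  have := isGalois hdim hρ
  rw [trace_eq_sum_automorphisms, univ_aut hdim hρ, Finset.sum_insert, Finset.sum_pair]
  · simp [add_assoc]
  · exact (gen_mul_gen_ne_gen hρ).symm
  · simp [(gen_ne_one hρ).symm, (gen_mul_gen_ne_one hρ).symm]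

theorem algebraMap_norm_eq (hdim : Module.finrank k l = 3) (hρ : Function.Injective ρ) (u : l) :
    algebraMap k l (Algebra.norm k u) = u * gen ρ u * gen ρ (gen ρ u) := by
  classical
  have : Module.Finite k l := Module.finite_of_finrank_eq_succ hdim
  have := isGalois hdim hρ
  rw [Algebra.norm_eq_prod_automorphisms, univ_aut hdim hρ, Finset.prod_insert, Finset.prod_pair]
  · simp [mul_assoc]
  · exact (gen_mul_gen_ne_gen hρ).symm
  · simp [(gen_ne_one hρ).symm, (gen_mul_gen_ne_one hρ).symm]

open Polynomial in
/-- The characteristic polynomial of the regular representation has coefficients in `k`. -/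
theorem exists_map_eq_charpoly (hdim : Module.finrank k l = 3) (hρ : Function.Injective ρ)
    (x : CyclicAlgebra ρ a) :
    ∃ p : k[X], (matrixRep ρ a x).charpoly = p.map (algebraMap k l) := by
  -- The three principal 2 × 2 minors are conjugate under `μ`, so their sum is the trace of the
  -- first one; the determinant is likewise a combination of norms and a trace.
  refine ⟨X ^ 3 - C (Algebra.trace k l x.x₀) * X ^ 2
    + C (Algebra.trace k l (x.x₀ * gen ρ x.x₀ - algebraMap k l a * (x.x₁ * gen ρ x.x₂))) * X
    - C (Algebra.norm k x.x₀ + a * Algebra.norm k x.x₁ + a ^ 2 * Algebra.norm k x.x₂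
      - a * Algebra.trace k l (x.x₀ * gen ρ x.x₁ * gen ρ (gen ρ x.x₂))), ?_⟩
  simp only [Polynomial.map_sub, Polynomial.map_add, Polynomial.map_mul, Polynomial.map_pow,
    Polynomial.map_X, Polynomial.map_C, algebraMap_trace_eq hdim hρ, algebraMap_norm_eq hdim hρ,
    map_sub, map_add, map_mul, map_pow, gen_gen_gen, AlgEquiv.commutes, Matrix.charpoly,
    Matrix.det_fin_three, Matrix.charmatrix_apply, matrixRep_apply]
  simp
  ring

/-- The reduced characteristic polynomial is that of the regular representation. -/
theorem map_reducedCharpoly (hdim : Module.finrank k l = 3) (hρ : Function.Injective ρ)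
    (x : CyclicAlgebra ρ a) :
    (reducedCharpoly k x).map (algebraMap k l) = (matrixRep ρ a x).charpoly := by
  obtain ⟨p, hp⟩ := exists_map_eq_charpoly hdim hρ x
  rw [(isReducedCharpoly hdim hρ hp).reducedCharpoly_eq, hp]

/-! ### Reduced norm and adjoint of the cyclic algebra. -/

theorem algebraMap_reducedNorm (hdim : Module.finrank k l = 3) (hρ : Function.Injective ρ)
    (x : CyclicAlgebra ρ a) :
    algebraMap k l (reducedNorm k x) = (matrixRep ρ a x).det := by
  rw [reducedNorm, map_neg, ← Polynomial.coeff_map, map_reducedCharpoly hdim hρ,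
    Matrix.det_eq_sign_charpoly_coeff]
  simp
  ring

theorem reducedNorm_mul (hdim : Module.finrank k l = 3) (hρ : Function.Injective ρ)
    (x y : CyclicAlgebra ρ a) : reducedNorm k (x * y) = reducedNorm k x * reducedNorm k y := by
  apply (algebraMap k l).injective
  simp [algebraMap_reducedNorm hdim hρ]

theorem reducedNorm_one (hdim : Module.finrank k l = 3) (hρ : Function.Injective ρ) :
    reducedNorm k (1 : CyclicAlgebra ρ a) = 1 := by
  apply (algebraMap k l).injective
  simp [algebraMap_reducedNorm hdim hρ]

theorem reducedNorm_ne_zero (hdim : Module.finrank k l = 3) (hρ : Function.Injective ρ)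
    {x : CyclicAlgebra ρ a} (hx : IsUnit x) : reducedNorm k x ≠ 0 := by
  obtain ⟨y, hy⟩ := hx.exists_right_inv
  intro h
  have := reducedNorm_mul hdim hρ x y
  rw [hy, reducedNorm_one hdim hρ, h, zero_mul] at this
  exact one_ne_zero this

theorem reducedNorm_eq (hdim : Module.finrank k l = 3) (hρ : Function.Injective ρ)
    (x : CyclicAlgebra ρ a) : reducedNorm k x = Algebra.norm k x.x₀ + a * Algebra.norm k x.x₁
      + a ^ 2 * Algebra.norm k x.x₂
      - a * Algebra.trace k l (x.x₀ * gen ρ x.x₁ * gen ρ (gen ρ x.x₂)) := by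
  apply (algebraMap k l).injective
  simp only [algebraMap_reducedNorm hdim hρ, map_sub, map_add, map_mul, map_pow,
    algebraMap_trace_eq hdim hρ, algebraMap_norm_eq hdim hρ, gen_gen_gen,
    Matrix.det_fin_three, matrixRep_apply]
  simp
  ring

open Polynomial in
/-- The Cayley–Hamilton identity `x x^♯ = n(x) 1`. -/
theorem mul_reducedAdjoint (hdim : Module.finrank k l = 3) (hρ : Function.Injective ρ)
    (x : CyclicAlgebra ρ a) :
    x * reducedAdjoint k x = algebraMap k _ (reducedNorm k x) := by
  set p := reducedCharpoly k x with hp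
  have hmap := map_reducedCharpoly hdim hρ x
  rw [← hp] at hmap
  have hdeg : p.natDegree = 3 := by
    rw [← Polynomial.natDegree_map (algebraMap k l), hmap, Matrix.charpoly_natDegree_eq_dim]
    simp
  have hmonic : p.Monic := by
    rw [← Polynomial.monic_map_iff (f := algebraMap k l), hmap]
    exact Matrix.charpoly_monic _
  have h3 : p.coeff 3 = 1 := by rw [← hdeg]; exact hmonic
  -- Cayley–Hamilton for the matrix over `l`, pulled back along the injective representation.
  have hz : aeval x p = 0 := by
    apply matrixRep_injective
    rw [map_zero, ← Polynomial.aeval_algHom_apply, ← Polynomial.aeval_map_algebraMap l, hmap]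
    exact Matrix.aeval_self_charpoly _
  rw [Polynomial.aeval_eq_sum_range, hdeg] at hz
  simp only [Finset.sum_range_succ, Finset.sum_range_zero, h3] at hz
  rw [reducedAdjoint, reducedNorm, reducedTrace, ← hp, map_neg, eq_neg_iff_add_eq_zero, ← hz]
  simp only [Algebra.algebraMap_eq_smul_one, mul_add, mul_sub, mul_smul_comm, neg_smul, mul_neg,
    pow_succ, pow_zero, one_mul, mul_one, one_smul, zero_add, mul_assoc]
  abel

/-- Cancel `x` on the left in `x x^♯ = n(x) 1`. -/
theorem reducedAdjoint_eq_smul (hdim : Module.finrank k l = 3) (hρ : Function.Injective ρ)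
    {x y : CyclicAlgebra ρ a} (h : y * x = 1) : reducedAdjoint k x = reducedNorm k x • y := by
  calc reducedAdjoint k x = y * (x * reducedAdjoint k x) := by rw [← mul_assoc, h, one_mul]
    _ = reducedNorm k x • y := by
      rw [mul_reducedAdjoint hdim hρ, ← Algebra.commutes, Algebra.smul_def]

/-- Required because `0 × w = -0^♯` by the definition of `cross`. -/
theorem reducedAdjoint_zero (hdim : Module.finrank k l = 3) (hρ : Function.Injective ρ) :
    reducedAdjoint k (0 : CyclicAlgebra ρ a) = 0 := by
  have h : (reducedCharpoly k (0 : CyclicAlgebra ρ a)).coeff 1 = 0 := by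
    apply (algebraMap k l).injective
    rw [← Polynomial.coeff_map, map_reducedCharpoly hdim hρ]
    simp [Matrix.charpoly_zero, Polynomial.coeff_X_pow]
  simp [reducedAdjoint, h]

end Splitting

end CyclicAlgebra

/-! ### Elements of rank one in the first Tits construction -/

namespace FirstTits

variable {k : Type*} [Field k] {A : Type*} [Ring A] [Algebra k A] {c : kˣ}

/-- If `♯` vanishes at `0` and `v^♯ = 0`, then `U_v` has its values on the line through `v`. -/
theorem U_of_sharp_eq_zero (h0 : sharp (A := A) c 0 = 0) {v : FirstTits A c}
    (hv : sharp c v = 0) (w : FirstTits A c) : U c v w = traceForm c v w • v := by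
  simp [U, cross, hv, h0]

/-- The vector `(1, 0, 0)` is not on the line through `(1, q, p)`: the third coordinate forces the
scalar to be `0`, the first forbids it. -/
theorem not_isJordanDivision_of_sharp_eq_zero [Nontrivial A] (h0 : sharp (A := A) c 0 = 0)
    {q p : A} (hp : p ≠ 0) (hv : sharp (A := A) c (1, q, p) = 0) :
    ¬ IsJordanDivision (U (A := A) c) := by
  intro h
  have hne : ((1, q, p) : FirstTits A c) ≠ 0 := fun h => one_ne_zero (congrArg Prod.fst h)
  obtain ⟨w, hw⟩ := (h _ hne).2 (1, 0, 0)
  rw [U_of_sharp_eq_zero h0 hv] at hw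
  have h1 := congrArg Prod.fst hw
  have h2 := congrArg (fun v => v.2.2) hw
  rcases smul_eq_zero.1 h2 with h3 | h3
  · simp only [h3, zero_smul] at h1
    exact zero_ne_one h1
  · exact hp h3

end FirstTits

/-! ### From values of the reduced norm to zeros of `♯`. -/

namespace CyclicAlgebra

variable {k l : Type*} [Field k] [Field l] [Algebra k l]
  {ρ : Multiplicative (ZMod 3) →* (l ≃ₐ[k] l)} {a c : kˣ}

instance : Nontrivial (CyclicAlgebra ρ a) :=
  ⟨0, 1, fun h => zero_ne_one (congrArg CyclicAlgebra.x₀ h)⟩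

/-- If `c` is the reduced norm of a unit of `A`, then `J(A, c)` is not a Jordan division algebra. -/
theorem not_isJordanDivision_of_reducedNorm_eq (hdim : Module.finrank k l = 3)
    (hρ : Function.Injective ρ) {p : CyclicAlgebra ρ a} (hp : IsUnit p)
    (hc : reducedNorm k p = c) :
    ¬ IsJordanDivision (FirstTits.U (A := CyclicAlgebra ρ a) c) := by
  obtain ⟨u, rfl⟩ := hp
  have hq : (c : k) * reducedNorm k (↑u⁻¹ : CyclicAlgebra ρ a) = 1 := by
    rw [← hc, ← reducedNorm_mul hdim hρ, Units.mul_inv, reducedNorm_one hdim hρ]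
  -- For `(1, u⁻¹, u)` the three coordinates of `♯` are `1 - u⁻¹ u`, `c⁻¹ n(u) u⁻¹ - u⁻¹` and `c
  -- n(u⁻¹) u - u`.
  refine FirstTits.not_isJordanDivision_of_sharp_eq_zero (q := ↑u⁻¹) (p := ↑u) ?_ u.ne_zero ?_
  · simp [FirstTits.sharp, reducedAdjoint_zero hdim hρ]
  · simp [FirstTits.sharp, reducedAdjoint_eq_smul hdim hρ (one_mul 1),
      reducedAdjoint_eq_smul hdim hρ u.inv_mul, reducedAdjoint_eq_smul hdim hρ u.mul_inv,
      reducedNorm_one hdim hρ, hc, smul_smul, hq]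

/-- If `c n_{l/k}(x)` is the reduced norm of a nonzero element of the division algebra `A`, then
`J(A, c)` is not a Jordan division algebra. -/
theorem not_isJordanDivision_of_mul_norm_eq (hdim : Module.finrank k l = 3)
    (hρ : Function.Injective ρ) (hdiv : ∀ x : CyclicAlgebra ρ a, x ≠ 0 → IsUnit x)
    {w : CyclicAlgebra ρ a} (hw : w ≠ 0) {x : l} (h : (c : k) * Algebra.norm k x = reducedNorm k w) :
    ¬ IsJordanDivision (FirstTits.U (A := CyclicAlgebra ρ a) c) := by
  have : Module.Finite k l := Module.finite_of_finrank_eq_succ hdim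
  have hx : Algebra.norm k x ≠ 0 :=
    right_ne_zero_of_mul (h ▸ reducedNorm_ne_zero hdim hρ (hdiv w hw))
  have hx0 : x ≠ 0 := fun h0 => hx (by rw [h0, Algebra.norm_zero])
  have hi : (⟨x⁻¹, 0, 0⟩ : CyclicAlgebra ρ a) ≠ 0 := fun h0 =>
    inv_ne_zero hx0 (congrArg CyclicAlgebra.x₀ h0)
  -- The unit of reduced norm `c` is `w x⁻¹`.
  refine not_isJordanDivision_of_reducedNorm_eq hdim hρ ((hdiv w hw).mul (hdiv _ hi)) ?_
  have hn : reducedNorm k (⟨x⁻¹, 0, 0⟩ : CyclicAlgebra ρ a) * Algebra.norm k x = 1 := by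
    rw [reducedNorm_eq hdim hρ]
    simp [Algebra.norm_zero, ← map_mul, hx0]
  rw [reducedNorm_mul hdim hρ, ← h, mul_assoc, mul_comm (Algebra.norm k x), hn, mul_one]

/-- The degree `3` is odd. -/
theorem norm_neg_eq (hdim : Module.finrank k l = 3) (y : l) :
    Algebra.norm k (-y) = -Algebra.norm k y := by
  rw [← neg_one_mul, map_mul, ← map_one (algebraMap k l), ← map_neg, Algebra.norm_algebraMap, hdim]
  ring

end CyclicAlgebra

theorem theorem2 {k l : Type*} [Field k] [Field l] [Algebra k l]
    (hchar : ringChar k ≠ 3) (ω : k) (hω : IsPrimitiveRoot ω 3)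
    (hdim : Module.finrank k l = 3) (b : k) (α : l) (hα : α ^ 3 = algebraMap k l b)
    (hgen : IntermediateField.adjoin k {α} = ⊤)
    (ρ : Multiplicative (ZMod 3) →* (l ≃ₐ[k] l)) (hρ : Function.Injective ρ)
    (a c : kˣ)
    (hdiv : ∀ x : CyclicAlgebra ρ a, x ≠ 0 → IsUnit x)
    (hrep :
      (Represents (diagTensor ![(c : k), (a : k)] (Algebra.norm k : l → k)) 1 ∨
        Represents (diagTensor ![(c : k), (a : k)] (Algebra.norm k : l → k)) ((a : k) ^ 2)) ∨
      (Represents (diagTensor ![(c : k), (a : k) ^ 2] (Algebra.norm k : l → k)) 1 ∨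
        Represents (diagTensor ![(c : k), (a : k) ^ 2] (Algebra.norm k : l → k)) (a : k))) :
    ¬ IsJordanDivision (FirstTits.U (A := CyclicAlgebra ρ a) c) := by
  have : Module.Finite k l := Module.finite_of_finrank_eq_succ hdim
  rcases hrep with (⟨v, hv⟩ | ⟨v, hv⟩) | (⟨v, hv⟩ | ⟨v, hv⟩) <;>
    simp only [diagTensor, Fin.sum_univ_two, Matrix.cons_val_zero, Matrix.cons_val_one] at hv
  -- Moving the second term of the form to the other side gives `c n(v 0) = 1 - a n(v 1) = n(1 - (v
  -- 1) z)`. The other cases use `-(v 1) z + z²`, `1 - (v 1) z²` and `z - (v 1) z²` in the same way.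
  · refine CyclicAlgebra.not_isJordanDivision_of_mul_norm_eq hdim hρ hdiv (w := ⟨1, -v 1, 0⟩)
      (x := v 0) (fun h => one_ne_zero (congrArg CyclicAlgebra.x₀ h)) ?_
    simp only [CyclicAlgebra.reducedNorm_eq hdim hρ, CyclicAlgebra.norm_neg_eq hdim, map_zero,
      map_one, Algebra.norm_zero, mul_zero]
    linear_combination hv
  · refine CyclicAlgebra.not_isJordanDivision_of_mul_norm_eq hdim hρ hdiv (w := ⟨0, -v 1, 1⟩)
      (x := v 0) (fun h => one_ne_zero (congrArg CyclicAlgebra.x₂ h)) ?_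
    simp only [CyclicAlgebra.reducedNorm_eq hdim hρ, CyclicAlgebra.norm_neg_eq hdim, map_zero,
      map_one, Algebra.norm_zero, mul_zero, zero_mul]
    linear_combination hv
  · refine CyclicAlgebra.not_isJordanDivision_of_mul_norm_eq hdim hρ hdiv (w := ⟨1, 0, -v 1⟩)
      (x := v 0) (fun h => one_ne_zero (congrArg CyclicAlgebra.x₀ h)) ?_
    simp only [CyclicAlgebra.reducedNorm_eq hdim hρ, CyclicAlgebra.norm_neg_eq hdim, map_zero,
      map_one, Algebra.norm_zero, mul_zero, zero_mul]
    linear_combination hv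
  · refine CyclicAlgebra.not_isJordanDivision_of_mul_norm_eq hdim hρ hdiv (w := ⟨0, 1, -v 1⟩)
      (x := v 0) (fun h => one_ne_zero (congrArg CyclicAlgebra.x₁ h)) ?_
    simp only [CyclicAlgebra.reducedNorm_eq hdim hρ, CyclicAlgebra.norm_neg_eq hdim, map_zero,
      map_one, Algebra.norm_zero, mul_zero, zero_mul]
    linear_combination hv
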